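/- A graph is a pair $G=(V,E)$ with $V\subseteq\omega$ a nonempty set of vertices and $E$ an irreflexive, symmetric edge relation on $V$; it is computable if $V$ and $E$ are computable. A subset of $V$ is identified with the subgraph that it induces. A vertex is isolated if it is adjacent to no vertex, and universal if it is adjacent to every other vertex; it has finite degree if it has only finitely many neighbors, and cofinite degree if it is adjacent to all but finitely many vertices. Two computable graphs are computably isomorphic if there is a computable isomorphism between them. A computable partition $G = X_0\sqcup X_1$ consists of disjoint computable sets $X_0,X_1$ with $X_0\cup X_1=V$. Let $G$ be a computable graph with at least two vertices. (1) Suppose that $G$ has isolated vertices but is not isomorphic to the edgeless graph $\overline{K}_\omega$ with vertex set $\omega$. If the set of vertices of finite degree is computably enumerable, then there is a computable partition $G = X_0 \sqcup X_1$ such that neither $X_0$ nor $X_1$ is computably isomorphic to $G$. (2) Suppose that $G$ has universal vertices but is not isomorphic to the complete graph $K_\omega$ with vertex set $\omega$. If the set of vertices of cofinite degree is computably enumerable, then there is a computable partition $G = X_0 \sqcup X_1$ such that neither $X_0$ nor $X_1$ is computably isomorphic to $G$. -/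

import Mathlib

/-- A graph whose vertices are natural numbers: a vertex set `G.verts : Set ℕ` with an irreflexive,
symmetric edge relation `G.Adj : ℕ → ℕ → Prop` which only relates elements of `G.verts`.
(These are exactly the subgraphs, not necessarily induced, of the complete graph on `ℕ`.)
For `X ⊆ G.verts`, `G.induce X` is the induced subgraph on `X`, and `G.coe` is `G` seen as
a `SimpleGraph` on the subtype `G.verts`. -/
abbrev NatGraph : Type := (⊤ : SimpleGraph ℕ).Subgraph

namespace NatGraph

/-- `G` is a computable graph: its vertex set and its edge relation are computable. -/
def IsComputable (G : NatGraph) : Prop :=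
  ComputablePred (fun x : ℕ => x ∈ G.verts) ∧
    ComputablePred (fun p : ℕ × ℕ => G.Adj p.1 p.2)

/-- `x` is an isolated vertex of `G`. -/
def IsIsolatedVertex (G : NatGraph) (x : ℕ) : Prop :=
  x ∈ G.verts ∧ ∀ y ∈ G.verts, ¬ G.Adj x y

/-- `x` is a universal vertex of `G`. -/
def IsUniversalVertex (G : NatGraph) (x : ℕ) : Prop :=
  x ∈ G.verts ∧ ∀ y ∈ G.verts, y ≠ x → G.Adj x y

/-- `x` is a vertex of `G` with only finitely many neighbors. -/
def HasFiniteDegree (G : NatGraph) (x : ℕ) : Prop :=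
  x ∈ G.verts ∧ {y | y ∈ G.verts ∧ G.Adj x y}.Finite

/-- `x` is a vertex of `G` which is adjacent to all but finitely many vertices. -/
def HasCofiniteDegree (G : NatGraph) (x : ℕ) : Prop :=
  x ∈ G.verts ∧ {y | y ∈ G.verts ∧ ¬ G.Adj x y}.Finite

/-- There is a computable isomorphism from `G` onto `H`: a graph isomorphism whose values on
the vertices of `G` are computed by a partial computable function. (If the vertex set of `G` is
computable, then the inverse isomorphism is computable as well.) -/
def ComputablyIsomorphic (G H : NatGraph) : Prop :=
  ∃ (φ : G.coe ≃g H.coe) (F : ℕ →. ℕ), Nat.Partrec F ∧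
    ∀ x : G.verts, F (x : ℕ) = Part.some (φ x : ℕ)

/-- `X₀`, `X₁` form a computable partition of the vertex set of `G`. -/
def IsComputablePartition (G : NatGraph) (X₀ X₁ : Set ℕ) : Prop :=
  ComputablePred (fun x : ℕ => x ∈ X₀) ∧ ComputablePred (fun x : ℕ => x ∈ X₁) ∧
    X₀ ∪ X₁ = G.verts ∧ Disjoint X₀ X₁

end NatGraph

/-! Part (2) is part (1) for the complement graph: complementation commutes with induced subgraphs
and preserves computable isomorphisms. Part (1) splits on whether the isolated vertices are c.e.

If they are, they form a computable set, because having a neighbor is c.e. When there is an edge,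
the isolated vertices are split from the rest: one side has no edge, the other no isolated vertex.
When there is none, the graph is finite and cardinality rules out proper subsets.

If they are not, a finite injury argument places the vertices one by one. Requirement `(e, i)` has
two tasks: the vertex `e`, if of infinite degree, gets a neighbor on side `i`; and the `e`-th
partial computable map is not an isomorphism onto side `i`. By the first task
(`exists_adj_bits_eq`), a vertex isolated on its side has finite degree in the graph, which the
hypothesis makes enumerable. For the second, while the map looks correct on an initial segment, its
values that look isolated are protected: their new neighbors go to the other side. If the map never
failed, protected values would stay isolated and the isolated vertices could be enumerated
(`exists_not_pass`). So it fails at some `x`; then only finitely many values, all of finite degree,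
are ever protected, and the demands stop (`eventually_not_restrain`). Induction on priority gives
`requirement`, and `exists_failure` reads off a failure of isomorphism. -/

/-! ### Bounded search and computable families of Boolean functions -/

/-- `boundedExists n p` decides whether `p k` holds for some `k < n`. -/
def boundedExists (n : ℕ) (p : ℕ → Bool) : Bool :=
  Nat.rec false (fun k r => r || p k) n

theorem boundedExists_iff {n : ℕ} {p : ℕ → Bool} :
    boundedExists n p = true ↔ ∃ k < n, p k = true := by
  induction n with
  | zero => simp [boundedExists]
  | succ n ih =>
    have h : boundedExists (n + 1) p = (boundedExists n p || p n) := rfl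
    rw [h, Bool.or_eq_true, ih]
    constructor
    · rintro (⟨k, hk, hp⟩ | hp)
      · exact ⟨k, by omega, hp⟩
      · exact ⟨n, by omega, hp⟩
    · rintro ⟨k, hk, hp⟩
      rcases Nat.lt_succ_iff_lt_or_eq.1 hk with h | rfl
      · exact Or.inl ⟨k, h, hp⟩
      · exact Or.inr hp

namespace Computable

variable {α : Type*} [Primcodable α]

theorem bool_or {p q : α → Bool} (hp : Computable p) (hq : Computable q) :
    Computable fun a => p a || q a :=
  Primrec.or.to_comp.comp hp hq

theorem bool_and {p q : α → Bool} (hp : Computable p) (hq : Computable q) :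
    Computable fun a => p a && q a :=
  Primrec.and.to_comp.comp hp hq

theorem bool_not {p : α → Bool} (hp : Computable p) : Computable fun a => !p a :=
  Primrec.not.to_comp.comp hp

theorem bool_beq {β : Type*} [Primcodable β] [DecidableEq β] {f g : α → β}
    (hf : Computable f) (hg : Computable g) : Computable fun a => f a == g a :=
  Primrec.beq.to_comp.comp hf hg

theorem decide_eq {β : Type*} [Primcodable β] [DecidableEq β] {f g : α → β}
    (hf : Computable f) (hg : Computable g) : Computable fun a => decide (f a = g a) :=
  Primrec.eq.decide.to_comp.comp hf hg

theorem boundedExists {n : α → ℕ} {p : α → ℕ → Bool} (hn : Computable n)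
    (hp : Computable fun q : α × ℕ => p q.1 q.2) :
    Computable fun a => _root_.boundedExists (n a) (p a) :=
  Computable.nat_rec hn (Computable.const false)
    (bool_or (snd.comp snd) (hp.comp (pair fst (fst.comp snd)))).to₂

theorem rePred_exists {f : α × ℕ → Bool} (hf : Computable f) :
    REPred fun a => ∃ s, f (a, s) = true := by
  have h : Partrec fun a => Nat.rfind fun s => Part.some (f (a, s)) :=
    Partrec.rfind (p := fun a s => Part.some (f (a, s))) hf.partrec
  refine h.dom_re.of_eq fun a => ?_
  refine Nat.rfind_dom.trans ⟨fun ⟨s, hs, _⟩ => ⟨s, (Part.mem_some_iff.1 hs).symm⟩, fun ⟨s, hs⟩ =>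
    ⟨s, Part.mem_some_iff.2 hs.symm, fun _ => trivial⟩⟩

end Computable

theorem ComputablePred.exists_bool {α : Type*} [Primcodable α] {p : α → Prop}
    (hp : ComputablePred p) : ∃ f : α → Bool, Computable f ∧ ∀ a, f a = true ↔ p a := by
  obtain ⟨f, hf, rfl⟩ := ComputablePred.computable_iff.1 hp
  exact ⟨f, hf, fun a => Iff.rfl⟩

theorem Computable.computablePred_of_iff {α : Type*} [Primcodable α] {p : α → Prop} {f : α → Bool}
    (hf : Computable f) (h : ∀ a, f a = true ↔ p a) : ComputablePred p :=
  ComputablePred.computable_iff.2 ⟨f, hf, funext fun a => propext (h a).symm⟩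

theorem ComputablePred.and_pred {α : Type*} [Primcodable α] {p q : α → Prop}
    (hp : ComputablePred p) (hq : ComputablePred q) : ComputablePred fun a => p a ∧ q a := by
  obtain ⟨f, hf, hfp⟩ := hp.exists_bool
  obtain ⟨g, hg, hgq⟩ := hq.exists_bool
  exact (Computable.bool_and hf hg).computablePred_of_iff fun a => by simp [hfp, hgq]

/-! ### A finite injury construction

The set `{v | bits v = i}` is built one vertex at a time, for both values of `i` at once. -/

/-- The data of the construction: `adj` is the adjacency relation, `seen x s` says that by stage `s`
the number `x` is known not to be an isolated vertex, and `early e x w s` says that by stage `s` the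
`e`-th partial map was seen to map `x` to `w`, and `w` was seen to be of finite degree, at a moment
when `x` was not yet known not to be isolated. -/
structure InjuryData where
  adj : ℕ → ℕ → Bool
  seen : ℕ → ℕ → Bool
  early : ℕ → ℕ → ℕ → ℕ → Bool

namespace InjuryData

variable (C : InjuryData)

/-- `w` has no neighbor yet on side `i`, given the list `h` of the decisions made so far. -/
def isoAt (i : Bool) (w : ℕ) (h : List Bool) : Bool :=
  !boundedExists h.length fun u => C.adj w u && (h.getD u false == i)

/-- `w` is an early value at `x` of the `e`-th map, it is on side `i`, and isolated there so far. -/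
def holds (e : ℕ) (i : Bool) (x w : ℕ) (h : List Bool) : Bool :=
  C.early e x w h.length && ((h.getD w false == i) && C.isoAt i w h)

/-- The map's verdict that `x` is isolated, to be compared with the opposite verdict `seen` of the
graph. -/
def declared (e : ℕ) (i : Bool) (x : ℕ) (h : List Bool) : Bool :=
  boundedExists h.length fun w => C.holds e i x w h

/-- There is currently no evidence at `x` that the `e`-th map is not an isomorphism. -/
def pass (e : ℕ) (i : Bool) (x : ℕ) (h : List Bool) : Bool :=
  !(C.declared e i x h == C.seen x h.length)

/-- An argument may restrain only while all smaller ones pass, so a permanent failure at `x`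
silences every argument above `x`. -/
def passBelow (e : ℕ) (i : Bool) (x : ℕ) (h : List Bool) : Bool :=
  !boundedExists x fun y => !C.pass e i y h

/-- The next vertex has to be kept away from side `i`. -/
def restrain (e : ℕ) (i : Bool) (h : List Bool) : Bool :=
  boundedExists h.length fun x => boundedExists h.length fun w =>
    C.passBelow e i x h && (C.holds e i x w h && C.adj w h.length)

/-- The next vertex would be the first neighbor of `e` on side `i`. -/
def attract (e : ℕ) (i : Bool) (h : List Bool) : Bool :=
  C.adj e h.length && C.isoAt i e h

/-- The number `n` codes the pair `(n.div2, n.bodd)`, whose first entry serves both as a vertex and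
as the index of a map. Attraction comes first: once stronger requirements are quiet it acts at most
once, so it harms the restraint only finitely often. -/
def demand (n : ℕ) (h : List Bool) : Option Bool :=
  bif C.attract n.div2 n.bodd h then some n.bodd
  else bif C.restrain n.div2 n.bodd h then some (!n.bodd) else none

/-- The first demand among those of the requirements with number less than `n`. -/
def firstDemand (n : ℕ) (h : List Bool) : Option Bool :=
  Nat.rec none (fun k r => r <|> C.demand k h) n

/-- At stage `s` only requirements below `s` are consulted, which keeps the search finite. The
default side is arbitrary. -/
def decision (h : List Bool) : Bool :=
  (C.firstDemand h.length h).getD false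

def history : ℕ → List Bool
  | 0 => []
  | s + 1 => history s ++ [C.decision (history s)]

def bits (s : ℕ) : Bool := C.decision (C.history s)

theorem history_eq (s : ℕ) : C.history s = (List.range s).map C.bits := by
  induction s with
  | zero => rfl
  | succ s ih => rw [List.range_succ, List.map_append, ← ih]; rfl

@[simp] theorem length_history (s : ℕ) : (C.history s).length = s := by simp [history_eq]

theorem getD_history {u s : ℕ} (h : u < s) : (C.history s).getD u false = C.bits u := by
  simp [history_eq, List.getD, h]

/-! #### Computability -/

/-- All components of the data are computable. -/
structure IsComputable : Prop where
  adj : Computable fun p : ℕ × ℕ => C.adj p.1 p.2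
  seen : Computable fun p : ℕ × ℕ => C.seen p.1 p.2
  early : Computable fun p : (ℕ × ℕ) × (ℕ × ℕ) => C.early p.1.1 p.1.2 p.2.1 p.2.2

variable {C}

section Computability

open Computable

variable {α : Type} [Primcodable α]
  {e x w : α → ℕ} {i : α → Bool} {h : α → List Bool}

theorem computable_bitEq (hw : Computable w) (hi : Computable i) (hh : Computable h) :
    Computable fun a => (h a).getD (w a) false == i a :=
  bool_beq ((Primrec.list_getD false).to_comp.comp hh hw) hi

theorem computable_isoAt (hC : C.IsComputable) (hi : Computable i) (hw : Computable w)
    (hh : Computable h) : Computable fun a => C.isoAt (i a) (w a) (h a) :=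
  bool_not <| boundedExists (list_length.comp hh) <| bool_and
    (hC.adj.comp (pair (hw.comp fst) snd))
    (computable_bitEq snd (hi.comp fst) (hh.comp fst))

theorem computable_holds (hC : C.IsComputable) (he : Computable e) (hi : Computable i)
    (hx : Computable x) (hw : Computable w) (hh : Computable h) :
    Computable fun a => C.holds (e a) (i a) (x a) (w a) (h a) :=
  bool_and (hC.early.comp (pair (pair he hx) (pair hw (list_length.comp hh))))
    (bool_and (computable_bitEq hw hi hh) (computable_isoAt hC hi hw hh))

theorem computable_declared (hC : C.IsComputable) (he : Computable e) (hi : Computable i)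
    (hx : Computable x) (hh : Computable h) :
    Computable fun a => C.declared (e a) (i a) (x a) (h a) :=
  boundedExists (list_length.comp hh) <|
    computable_holds hC (he.comp fst) (hi.comp fst) (hx.comp fst) snd (hh.comp fst)

theorem computable_pass (hC : C.IsComputable) (he : Computable e) (hi : Computable i)
    (hx : Computable x) (hh : Computable h) :
    Computable fun a => C.pass (e a) (i a) (x a) (h a) :=
  bool_not <| bool_beq (computable_declared hC he hi hx hh)
    (hC.seen.comp (pair hx (list_length.comp hh)))

theorem computable_passBelow (hC : C.IsComputable) (he : Computable e) (hi : Computable i)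
    (hx : Computable x) (hh : Computable h) :
    Computable fun a => C.passBelow (e a) (i a) (x a) (h a) :=
  bool_not <| boundedExists hx <| bool_not <|
    computable_pass hC (he.comp fst) (hi.comp fst) snd (hh.comp fst)

theorem computable_restrain (hC : C.IsComputable) (he : Computable e) (hi : Computable i)
    (hh : Computable h) : Computable fun a => C.restrain (e a) (i a) (h a) :=
  boundedExists (list_length.comp hh) <| boundedExists (list_length.comp (hh.comp fst)) <|
    have h1 {β : Type} [Primcodable β] {f : α → β} (hf : Computable f) :
      Computable fun q : (α × ℕ) × ℕ => f q.1.1 := hf.comp (fst.comp fst)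
    bool_and (computable_passBelow hC (h1 he) (h1 hi) (snd.comp fst) (h1 hh)) <|
      bool_and (computable_holds hC (h1 he) (h1 hi) (snd.comp fst) snd (h1 hh))
        (hC.adj.comp (pair snd (list_length.comp (h1 hh))))

theorem computable_attract (hC : C.IsComputable) (he : Computable e) (hi : Computable i)
    (hh : Computable h) : Computable fun a => C.attract (e a) (i a) (h a) :=
  bool_and (hC.adj.comp (pair he (list_length.comp hh))) (computable_isoAt hC hi he hh)

theorem computable_demand (hC : C.IsComputable) (he : Computable e) (hh : Computable h) :
    Computable fun a => C.demand (e a) (h a) :=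
  have h1 := nat_div2.comp he
  have h2 := nat_bodd.comp he
  cond (computable_attract hC h1 h2 hh) (option_some.comp h2)
    (cond (computable_restrain hC h1 h2 hh) (option_some.comp (bool_not h2)) (const none))

theorem computable_decision (hC : C.IsComputable) : Computable C.decision :=
  option_getD
    (nat_rec list_length (const none)
      (Primrec.option_orElse.to_comp.comp (snd.comp snd)
        (computable_demand hC (fst.comp snd) fst)).to₂) (const false)

theorem computable_history (hC : C.IsComputable) : Computable C.history :=
  (nat_rec Computable.id (const [])
    (list_concat.comp (snd.comp snd) ((computable_decision hC).comp (snd.comp snd))).to₂).of_eq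
    fun s => by
      induction s with
      | zero => rfl
      | succ s ih => exact congrArg (fun l => l ++ [C.decision l]) ih

theorem computable_bits (hC : C.IsComputable) : Computable C.bits :=
  (computable_decision hC).comp (computable_history hC)

end Computability

end InjuryData

namespace InjuryData

variable {C : InjuryData}

/-! #### Verification -/

theorem isoAt_history {i : Bool} {w s : ℕ} :
    C.isoAt i w (C.history s) = true ↔ ∀ u < s, C.adj w u = true → C.bits u ≠ i := by
  rw [isoAt, Bool.not_eq_true', ← Bool.not_eq_true, boundedExists_iff]
  push Not
  rw [length_history]
  refine forall₂_congr fun u hu => ?_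
  rw [getD_history C hu]
  simp

theorem firstDemand_eq {n : ℕ} {c : Bool} {h : List Bool} (hlow : ∀ m < n, C.demand m h = none)
    (hn : C.demand n h = some c) {k : ℕ} (hk : n < k) : C.firstDemand k h = some c := by
  have hstep : ∀ k, C.firstDemand (k + 1) h = (C.firstDemand k h <|> C.demand k h) := fun _ => rfl
  have h0 : ∀ k ≤ n, C.firstDemand k h = none := by
    intro k
    induction k with
    | zero => intro _; rfl
    | succ k ih => intro hk; rw [hstep, ih (by omega), hlow k (by omega)]; rfl
  induction k, hk using Nat.le_induction with
  | base => rw [hstep, h0 n le_rfl, hn]; rfl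
  | succ k _ ih => rw [hstep, ih]; rfl

theorem bits_eq_of_demand {n s : ℕ} {c : Bool} (hns : n < s)
    (hlow : ∀ m < n, C.demand m (C.history s) = none)
    (hn : C.demand n (C.history s) = some c) : C.bits s = c := by
  rw [bits, decision, length_history, firstDemand_eq hlow hn hns]; rfl

variable (C) in
/-- The properties of the data which the verification needs. -/
structure IsLawful : Prop where
  seen_mono : ∀ {x s t}, s ≤ t → C.seen x s = true → C.seen x t = true
  early_mono : ∀ {e x w s t}, s ≤ t → C.early e x w s = true → C.early e x w t = true
  early_arg_lt : ∀ {e x w s}, C.early e x w s = true → x < s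
  early_val_lt : ∀ {e x w s}, C.early e x w s = true → w < s
  early_unique : ∀ {e x w w' s s'}, C.early e x w s = true → C.early e x w' s' = true → w = w'
  early_of_seen : ∀ {e x w s t}, s ≤ t → C.seen x s = true → C.early e x w t = true →
    C.early e x w s = true
  finite_adj : ∀ {e x w s}, C.early e x w s = true → {v | C.adj w v = true}.Finite

theorem attract_history {e s : ℕ} {i : Bool} : C.attract e i (C.history s) = true ↔
    C.adj e s = true ∧ ∀ u < s, C.adj e u = true → C.bits u ≠ i := by
  rw [attract, Bool.and_eq_true, isoAt_history, length_history]

theorem pass_history {e x s : ℕ} {i : Bool} : C.pass e i x (C.history s) = true ↔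
    (C.declared e i x (C.history s) = true ↔ ¬ C.seen x s = true) := by
  rw [pass, length_history]
  cases C.declared e i x (C.history s) <;> cases C.seen x s <;> simp

theorem passBelow_history {e x s : ℕ} {i : Bool} : C.passBelow e i x (C.history s) = true ↔
    ∀ y < x, C.pass e i y (C.history s) = true := by
  rw [passBelow, Bool.not_eq_true', ← Bool.not_eq_true, boundedExists_iff]
  simp

namespace IsLawful

variable (hL : C.IsLawful)

include hL

theorem holds_history {e x w s : ℕ} {i : Bool} : C.holds e i x w (C.history s) = true ↔
    C.early e x w s = true ∧ C.bits w = i ∧ ∀ u < s, C.adj w u = true → C.bits u ≠ i := by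
  rw [holds, Bool.and_eq_true, Bool.and_eq_true, isoAt_history, length_history]
  refine and_congr_right fun h => ?_
  rw [getD_history C (hL.early_val_lt h), beq_iff_eq]

theorem declared_history {e x s : ℕ} {i : Bool} : C.declared e i x (C.history s) = true ↔
    ∃ w, C.holds e i x w (C.history s) = true := by
  rw [declared, boundedExists_iff, length_history]
  exact exists_congr fun w =>
    ⟨And.right, fun h => ⟨hL.early_val_lt (hL.holds_history.1 h).1, h⟩⟩

theorem restrain_history {e s : ℕ} {i : Bool} : C.restrain e i (C.history s) = true ↔
    ∃ x w, C.passBelow e i x (C.history s) = true ∧ C.holds e i x w (C.history s) = true ∧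
      C.adj w s = true := by
  simp only [restrain, boundedExists_iff, length_history, Bool.and_eq_true]
  constructor
  · rintro ⟨x, -, w, -, h⟩
    exact ⟨x, w, h⟩
  · rintro ⟨x, w, h⟩
    have he := (hL.holds_history.1 h.2.1).1
    exact ⟨x, hL.early_arg_lt he, w, hL.early_val_lt he, h⟩

/-- Isolation on a side can only be lost as vertices are placed; `early` is the only increasing
ingredient of `holds`. -/
theorem holds_anti {e x w s t : ℕ} {i : Bool} (hst : s ≤ t)
    (hs : C.early e x w s = true) (ht : C.holds e i x w (C.history t) = true) :
    C.holds e i x w (C.history s) = true := by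
  rw [hL.holds_history] at *
  exact ⟨hs, ht.2.1, fun u hu => ht.2.2 u (hu.trans_le hst)⟩

/-- By `early_unique` a single value is involved, and `holds` is antitone once that value is early.
A declaration that keeps recurring therefore never lapses after its first occurrence. -/
theorem eventually_declared (e : ℕ) (i : Bool) (x : ℕ) :
    (∃ s₀, ∀ s ≥ s₀, C.declared e i x (C.history s) = true) ∨
      ∃ s₀, ∀ s ≥ s₀, ¬ C.declared e i x (C.history s) = true := by
  by_cases h : ∃ s₀, ∀ s ≥ s₀, ¬ C.declared e i x (C.history s) = true
  · exact Or.inr h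
  · left
    push Not at h
    obtain ⟨s, -, hs⟩ := h 0
    obtain ⟨w, hw⟩ := hL.declared_history.1 hs
    have hew := (hL.holds_history.1 hw).1
    refine ⟨s, fun t ht => ?_⟩
    obtain ⟨t', ht', hdt'⟩ := h t
    obtain ⟨w', hw'⟩ := hL.declared_history.1 hdt'
    obtain rfl := hL.early_unique hew (hL.holds_history.1 hw').1
    exact hL.declared_history.2 ⟨w, hL.holds_anti ht' (hL.early_mono ht hew) hw'⟩

theorem eventually_seen (x : ℕ) :
    (∃ s₀, ∀ s ≥ s₀, C.seen x s = true) ∨ ∀ s, ¬ C.seen x s = true := by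
  by_cases h : ∃ s, C.seen x s = true
  · obtain ⟨s, hs⟩ := h
    exact Or.inl ⟨s, fun t ht => hL.seen_mono ht hs⟩
  · push Not at h
    exact Or.inr h

theorem eventually_pass (e : ℕ) (i : Bool) (x : ℕ) :
    (∃ s₀, ∀ s ≥ s₀, C.pass e i x (C.history s) = true) ∨
      ∃ s₀, ∀ s ≥ s₀, ¬ C.pass e i x (C.history s) = true := by
  simp only [pass_history]
  rcases hL.eventually_declared e i x with ⟨s₀, h₀⟩ | ⟨s₀, h₀⟩ <;>
    rcases hL.eventually_seen x with ⟨s₁, h₁⟩ | h₁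
  · refine Or.inr ⟨max s₀ s₁, fun s hs => ?_⟩
    simp [h₀ s (le_of_max_le_left hs), h₁ s (le_of_max_le_right hs)]
  · refine Or.inl ⟨s₀, fun s hs => ?_⟩
    simp [h₀ s hs, h₁ s]
  · refine Or.inl ⟨max s₀ s₁, fun s hs => ?_⟩
    simp [h₀ s (le_of_max_le_left hs), h₁ s (le_of_max_le_right hs)]
  · refine Or.inr ⟨s₀, fun s hs => ?_⟩
    simp [h₀ s hs, h₁ s]

/-- An obeyed restraint keeps its vertex isolated. -/
theorem holds_forever {e x w s₀ s : ℕ} {i : Bool}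
    (hobey : ∀ s ≥ s₀, C.restrain e i (C.history s) = true → C.bits s = !i) (hs : s₀ ≤ s)
    (hbelow : ∀ t ≥ s, C.passBelow e i x (C.history t) = true)
    (hw : C.holds e i x w (C.history s) = true) :
    ∀ t ≥ s, C.holds e i x w (C.history t) = true := by
  intro t ht
  induction t, ht using Nat.le_induction with
  | base => exact hw
  | succ t ht ih =>
    have h := hL.holds_history.1 ih
    refine hL.holds_history.2 ⟨hL.early_mono t.le_succ h.1, h.2.1, fun u hu ha => ?_⟩
    rcases Nat.lt_succ_iff_lt_or_eq.1 hu with hu | rfl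
    · exact h.2.2 u hu ha
    · rw [hobey u (hs.trans ht) (hL.restrain_history.2 ⟨x, w, hbelow u ht, ih, ha⟩)]
      cases i <;> simp

/-- There are two ways to pass. If `x` is declared and unseen, obeyed restraints preserve the
declaration, and seeing `x` later would make it fail for good, against `hpass`. If `x` is seen and
undeclared, `early_of_seen` excludes new values and `holds_anti` the return of an old one. -/
theorem pass_forever {e s₀ : ℕ} {i : Bool}
    (hobey : ∀ s ≥ s₀, C.restrain e i (C.history s) = true → C.bits s = !i)
    (hpass : ∀ x, ∃ s₁, ∀ s ≥ s₁, C.pass e i x (C.history s) = true) (x : ℕ) :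
    ∀ s ≥ s₀, (∀ y ≤ x, C.pass e i y (C.history s) = true) →
      ∀ t ≥ s, C.pass e i x (C.history t) = true := by
  induction x using Nat.strong_induction_on with
  | _ x ih =>
    intro s hs hp t ht
    have hbelow : ∀ t ≥ s, C.passBelow e i x (C.history t) = true := fun t ht =>
      passBelow_history.2 fun y hy => ih y hy s hs (fun z hz => hp z (hz.trans hy.le)) t ht
    have hx := pass_history.1 (hp x le_rfl)
    rw [pass_history]
    by_cases hd : C.declared e i x (C.history s) = true
    · obtain ⟨w, hw⟩ := hL.declared_history.1 hd
      have hf := hL.holds_forever hobey hs hbelow hw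
      refine iff_of_true (hL.declared_history.2 ⟨w, hf t ht⟩) fun hseen => ?_
      obtain ⟨s₁, h₁⟩ := hpass x
      exact (pass_history.1 (h₁ (max s₁ t) (le_max_left _ _))).1
        (hL.declared_history.2 ⟨w, hf _ (ht.trans (le_max_right _ _))⟩)
        (hL.seen_mono (le_max_right _ _) hseen)
    · have hseen : C.seen x s = true := by
        by_contra hc
        exact hd (hx.2 hc)
      refine iff_of_false (fun hdt => hd ?_) (not_not.2 (hL.seen_mono ht hseen))
      obtain ⟨w, hw⟩ := hL.declared_history.1 hdt
      exact hL.declared_history.2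
        ⟨w, hL.holds_anti ht (hL.early_of_seen ht hseen (hL.holds_history.1 hw).1) hw⟩

/-- If the restraints of the `e`-th map are eventually obeyed, then this map fails somewhere,
because otherwise the set of isolated vertices would be computably enumerable. -/
theorem exists_not_pass (hC : C.IsComputable) (hI : ¬ REPred fun x => ∀ s, ¬ C.seen x s = true)
    {e s₀ : ℕ} {i : Bool}
    (hobey : ∀ s ≥ s₀, C.restrain e i (C.history s) = true → C.bits s = !i) :
    ∃ x s₁, ∀ s ≥ s₁, ¬ C.pass e i x (C.history s) = true := by
  by_contra hcon
  have hpass : ∀ x, ∃ s₁, ∀ s ≥ s₁, C.pass e i x (C.history s) = true := fun x =>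
    (hL.eventually_pass e i x).resolve_right fun h => hcon ⟨x, h⟩
  refine hI ?_
  -- The enumeration accepts `x` at a stage past `s₀` where all smaller arguments pass and `x` is
  -- declared but unseen.
  have hcomp : Computable fun p : ℕ × ℕ =>
      (!decide (p.2 < s₀)) && (C.passBelow e i p.1 (C.history p.2) &&
        (C.declared e i p.1 (C.history p.2) && !C.seen p.1 p.2)) := by
    have h2 : Computable fun p : ℕ × ℕ => C.history p.2 :=
      (computable_history hC).comp Computable.snd
    refine Computable.bool_and (Computable.bool_not ?_) (Computable.bool_and
      (computable_passBelow hC (.const e) (.const i) .fst h2) (Computable.bool_and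
      (computable_declared hC (.const e) (.const i) .fst h2) (Computable.bool_not hC.seen)))
    exact Primrec.nat_lt.decide.to_comp.comp Computable.snd (Computable.const s₀)
  refine (Computable.rePred_exists hcomp).of_eq fun x => ?_
  simp only [Bool.and_eq_true, Bool.not_eq_true', decide_eq_false_iff_not, not_lt]
  constructor
  · rintro ⟨s, hs, hb, hd, hn⟩ t ht
    have hn' : ¬ C.seen x s = true := by simp [hn]
    have hp : ∀ y ≤ x, C.pass e i y (C.history s) = true := fun y hy => by
      rcases hy.lt_or_eq with hy | rfl
      · exact passBelow_history.1 hb y hy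
      · exact pass_history.2 (iff_of_true hd hn')
    obtain ⟨w, hw⟩ := hL.declared_history.1 hd
    have hf := hL.holds_forever hobey hs (fun t ht => passBelow_history.2 fun y hy =>
      hL.pass_forever hobey hpass y s hs (fun z hz => hp z (hz.trans hy.le)) t ht) hw
    exact (pass_history.1 (hL.pass_forever hobey hpass x s hs hp (max s t) (le_max_left _ _))).1
      (hL.declared_history.2 ⟨w, hf _ (le_max_left _ _)⟩) (hL.seen_mono (le_max_right _ _) ht)
  · intro hx
    -- Once all arguments up to `x` have settled, an isolated `x` is accepted, since passing unseen
    -- means being declared.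
    choose s₁ hs₁ using hpass
    have hle : ∀ y ≤ x, s₁ y ≤ (Finset.range (x + 1)).sup s₁ := fun y hy =>
      Finset.le_sup (f := s₁) (Finset.mem_range.2 (Nat.lt_succ_of_le hy))
    have hp : ∀ y ≤ x, C.pass e i y (C.history (max s₀ ((Finset.range (x + 1)).sup s₁))) = true :=
      fun y hy => hs₁ y _ ((hle y hy).trans (le_max_right _ _))
    exact ⟨_, le_max_left _ _, passBelow_history.2 fun y hy => hp y hy.le,
      (pass_history.1 (hp x le_rfl)).2 (hx _), by simpa using hx _⟩

/-- Only arguments up to the failing `x` can still restrain; each has at most one value, and that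
value has finitely many neighbors. -/
theorem eventually_not_restrain {e x s₁ : ℕ} {i : Bool}
    (hx : ∀ s ≥ s₁, ¬ C.pass e i x (C.history s) = true) :
    ∃ s₂, ∀ s ≥ s₂, ¬ C.restrain e i (C.history s) = true := by
  have hfin : (⋃ y ∈ Set.Iic x, {v | ∃ w s, C.early e y w s = true ∧ C.adj w v = true}).Finite := by
    refine (Set.finite_Iic x).biUnion fun y _ => ?_
    by_cases h : ∃ w s, C.early e y w s = true
    · obtain ⟨w, s, hw⟩ := h
      refine (hL.finite_adj hw).subset ?_
      rintro v ⟨w', s', hw', hv⟩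
      rwa [hL.early_unique hw hw']
    · refine Set.finite_empty.subset ?_
      rintro v ⟨w', s', hw', -⟩
      exact h ⟨w', s', hw'⟩
  obtain ⟨B, hB⟩ := hfin.bddAbove
  refine ⟨max s₁ (B + 1), fun s hs hr => ?_⟩
  obtain ⟨y, w, hb, hh, ha⟩ := hL.restrain_history.1 hr
  have hyx : y ≤ x := by
    by_contra hc
    exact hx s (le_of_max_le_left hs) (passBelow_history.1 hb x (not_le.1 hc))
  have : s ≤ B := hB (Set.mem_biUnion (Set.mem_Iic.2 hyx) ⟨w, s, (hL.holds_history.1 hh).1, ha⟩)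
  have := le_of_max_le_right hs
  omega

/-- Every requirement makes only finitely many demands, and every map fails somewhere. -/
theorem requirement (hC : C.IsComputable) (hI : ¬ REPred fun x => ∀ s, ¬ C.seen x s = true)
    (n : ℕ) : (∃ s₀, ∀ s ≥ s₀, C.demand n (C.history s) = none) ∧
      ∃ x s₁, ∀ s ≥ s₁, ¬ C.pass n.div2 n.bodd x (C.history s) = true := by
  induction n using Nat.strong_induction_on with
  | _ n ih =>
    -- The bound `s₀ > n` ensures that requirement `n` is consulted at these stages.
    have hlow : ∃ s₀ > n, ∀ s ≥ s₀, ∀ m < n, C.demand m (C.history s) = none := by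
      choose! f hf using fun m hm => (ih m hm).1
      refine ⟨max (n + 1) ((Finset.range n).sup f), lt_max_of_lt_left n.lt_succ_self,
        fun s hs m hm => hf m hm s ?_⟩
      exact (Finset.le_sup (f := f) (Finset.mem_range.2 hm)).trans (le_of_max_le_right hs)
    obtain ⟨s₀, hns, hlow⟩ := hlow
    -- An attraction past `s₀` is obeyed and supplies the neighbor it asks for, so it never recurs.
    have hattract : ∃ s₁ ≥ s₀, ∀ s ≥ s₁, ¬ C.attract n.div2 n.bodd (C.history s) = true := by
      by_cases h : ∃ s ≥ s₀, C.attract n.div2 n.bodd (C.history s) = true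
      · obtain ⟨s, hs, ha⟩ := h
        have hb : C.bits s = n.bodd :=
          bits_eq_of_demand (hns.trans_le hs) (hlow s hs) (by simp [demand, ha])
        refine ⟨s + 1, by omega, fun t ht hat => ?_⟩
        exact (attract_history.1 hat).2 s ht (attract_history.1 ha).1 hb
      · push Not at h
        exact ⟨s₀, le_rfl, h⟩
    obtain ⟨s₁, hs₁, hattract⟩ := hattract
    have hobey : ∀ s ≥ s₁, C.restrain n.div2 n.bodd (C.history s) = true →
        C.bits s = !n.bodd := fun s hs hr =>
      bits_eq_of_demand (by omega) (hlow s (hs₁.trans hs))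
        (by simp [demand, hattract s hs, hr])
    obtain ⟨x, s₂, hx⟩ := hL.exists_not_pass hC hI hobey
    obtain ⟨s₃, h₃⟩ := hL.eventually_not_restrain hx
    refine ⟨⟨max s₁ s₃, fun s hs => ?_⟩, x, s₂, hx⟩
    simp [demand, hattract s (le_of_max_le_left hs), h₃ s (le_of_max_le_right hs)]

/-- A vertex of infinite degree gets a neighbor on either side. -/
theorem exists_adj_bits_eq (hC : C.IsComputable)
    (hI : ¬ REPred fun x => ∀ s, ¬ C.seen x s = true) {w : ℕ}
    (hw : {v | C.adj w v = true}.Infinite) (i : Bool) :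
    ∃ u, C.adj w u = true ∧ C.bits u = i := by
  obtain ⟨s₀, h₀⟩ := (hL.requirement hC hI (Nat.bit i w)).1
  obtain ⟨v, hv, hlt⟩ := hw.exists_gt s₀
  by_contra hcon
  push Not at hcon
  have ha : C.attract w i (C.history v) = true :=
    attract_history.2 ⟨hv, fun u _ hu => hcon u hu⟩
  have := h₀ v hlt.le
  simp [demand, ha] at this

/-- The `e`-th map maps a vertex which is not isolated to an isolated vertex on side `i`, or it does
not map a certain isolated vertex to a vertex of finite degree which is isolated on side `i`. -/
theorem exists_failure (hC : C.IsComputable) (hI : ¬ REPred fun x => ∀ s, ¬ C.seen x s = true)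
    (e : ℕ) (i : Bool) : ∃ x,
      ((∃ s, C.seen x s = true) ∧ ∃ w s, C.early e x w s = true ∧ C.bits w = i ∧
        ∀ u, C.adj w u = true → C.bits u ≠ i) ∨
      ((∀ s, ¬ C.seen x s = true) ∧ ¬ ∃ w s, C.early e x w s = true ∧ C.bits w = i ∧
        ∀ u, C.adj w u = true → C.bits u ≠ i) := by
  obtain ⟨x, s₁, hx⟩ := (hL.requirement hC hI (Nat.bit i e)).2
  simp only [Nat.div2_bit, Nat.bodd_bit, pass_history] at hx
  refine ⟨x, ?_⟩
  by_cases hseen : ∃ s, C.seen x s = true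
  · refine Or.inl ⟨hseen, ?_⟩
    obtain ⟨s, hs⟩ := hseen
    have hdec : ∀ t ≥ max s s₁, C.declared e i x (C.history t) = true := fun t ht => by
      have h1 := hx t (le_of_max_le_right ht)
      have h2 := hL.seen_mono (le_of_max_le_left ht) hs
      by_contra hc
      exact h1 (iff_of_false hc (not_not.2 h2))
    obtain ⟨w, hw⟩ := hL.declared_history.1 (hdec _ le_rfl)
    have h := hL.holds_history.1 hw
    refine ⟨w, _, h.1, h.2.1, fun u hu => ?_⟩
    -- A stage beyond `u` is needed to exclude `u` as a neighbor on side `i`; uniqueness of values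
    -- identifies `w'` with `w`.
    obtain ⟨w', hw'⟩ := hL.declared_history.1
      (hdec (max (max s s₁) (u + 1)) (le_max_left _ _))
    have h' := hL.holds_history.1 hw'
    obtain rfl := hL.early_unique h.1 h'.1
    exact h'.2.2 u (Nat.lt_of_succ_le (le_max_right _ _)) hu
  · push Not at hseen
    refine Or.inr ⟨hseen, ?_⟩
    rintro ⟨w, s, he, hb, hiso⟩
    refine hx (max s s₁) (le_max_right _ _) (iff_of_true (hL.declared_history.2 ⟨w, ?_⟩) (hseen _))
    exact hL.holds_history.2 ⟨hL.early_mono (le_max_left _ _) he, hb, fun u _ => hiso u⟩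

end IsLawful

end InjuryData

namespace NatGraph

/-! ### Stage approximations for a computable graph. -/

open Nat.Partrec (Code)

theorem exists_code_of_rePred {p : ℕ → Prop} (hp : REPred p) :
    ∃ c : Code, ∀ x, (c.eval x).Dom ↔ p x := by
  have h : Partrec fun a => (Part.assert (p a) fun _ => Part.some ()).map fun _ => (0 : ℕ) :=
    Partrec.map hp (Computable.const 0).to₂
  obtain ⟨c, hc⟩ := Code.exists_code.1 (Partrec.nat_iff.1 h)
  refine ⟨c, fun x => ?_⟩
  rw [hc]
  exact ⟨fun h => h.1, fun h => ⟨h, trivial⟩⟩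

theorem computable_ofNat_code : Computable (Denumerable.ofNat Code) := Computable.ofNat Code

theorem computable_evaln {α : Type} [Primcodable α] {t x : α → ℕ} {c : α → Code}
    (ht : Computable t) (hc : Computable c) (hx : Computable x) :
    Computable fun a => Code.evaln (t a) (c a) (x a) :=
  Code.primrec_evaln.to_comp.comp ((ht.pair hc).pair hx)

theorem computable_evaln_eq {α : Type} [Primcodable α] {t x e w : α → ℕ}
    (ht : Computable t) (he : Computable e) (hx : Computable x) (hw : Computable w) :
    Computable fun a => decide (Code.evaln (t a) (Denumerable.ofNat Code (e a)) (x a) = some (w a)) :=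
  Computable.decide_eq (computable_evaln ht (computable_ofNat_code.comp he) hx)
    (Computable.option_some.comp hw)

theorem computable_evaln_isSome {α : Type} [Primcodable α] {t x : α → ℕ} (c : Code)
    (ht : Computable t) (hx : Computable x) :
    Computable fun a => (Code.evaln (t a) c (x a)).isSome :=
  Primrec.option_isSome.to_comp.comp (computable_evaln ht (.const c) hx)

/-- The data of the finite injury construction for the graph with vertex set `V` and adjacency
relation `a`, where `c` enumerates the vertices of finite degree. -/
def injuryData (V : ℕ → Bool) (a : ℕ → ℕ → Bool) (c : Code) : InjuryData where
  adj := a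
  -- Non-vertices count as seen from the start, so the numbers never seen are exactly the isolated
  -- vertices.
  seen x s := !V x || boundedExists s fun u => a x u
  -- The search covers `t ≤ s`. Since `evaln` at `t` only accepts inputs below `t`, both `x` and `w`
  -- are below `s`.
  early e x w s := boundedExists (s + 1) fun t =>
    decide (Code.evaln t (Denumerable.ofNat Code e) x = some w) &&
      ((Code.evaln t c w).isSome && !(!V x || boundedExists t fun u => a x u))

section

variable {V : ℕ → Bool} {a : ℕ → ℕ → Bool} {c : Code}

theorem injuryData_seen {x s : ℕ} : (injuryData V a c).seen x s = true ↔
    (V x = true → ∃ u < s, a x u = true) := by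
  simp only [injuryData, Bool.or_eq_true, boundedExists_iff]
  cases V x <;> simp

theorem injuryData_early {e x w s : ℕ} : (injuryData V a c).early e x w s = true ↔
    ∃ t ≤ s, w ∈ Code.evaln t (Denumerable.ofNat Code e) x ∧ (∃ k, k ∈ Code.evaln t c w) ∧
      ¬ (injuryData V a c).seen x t = true := by
  simp only [injuryData, boundedExists_iff, Bool.and_eq_true, decide_eq_true_eq, Option.mem_def,
    Option.isSome_iff_exists, Bool.not_eq_true', Bool.not_eq_true, Nat.lt_succ_iff]

theorem computable_injuryData_seen {α : Type} [Primcodable α] (hV : Computable V)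
    (ha : Computable fun p : ℕ × ℕ => a p.1 p.2) {x s : α → ℕ} (hx : Computable x)
    (hs : Computable s) :
    Computable fun p => !V (x p) || boundedExists (s p) fun u => a (x p) u :=
  Computable.bool_or (Computable.bool_not (hV.comp hx)) (Computable.boundedExists hs
    (ha.comp (Computable.pair (hx.comp .fst) .snd)))

theorem computable_injuryData_early {α : Type} [Primcodable α] (hV : Computable V)
    (ha : Computable fun p : ℕ × ℕ => a p.1 p.2) {e x w s : α → ℕ} (he : Computable e)
    (hx : Computable x) (hw : Computable w) (hs : Computable s) :
    Computable fun p => boundedExists (s p + 1) fun t =>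
      decide (Code.evaln t (Denumerable.ofNat Code (e p)) (x p) = some (w p)) &&
        ((Code.evaln t c (w p)).isSome &&
          !(!V (x p) || boundedExists t fun u => a (x p) u)) :=
  Computable.boundedExists (Computable.succ.comp hs) <|
    Computable.bool_and (computable_evaln_eq .snd (he.comp .fst) (hx.comp .fst) (hw.comp .fst)) <|
      Computable.bool_and (computable_evaln_isSome c .snd (hw.comp .fst)) <|
        Computable.bool_not (computable_injuryData_seen hV ha (hx.comp .fst) .snd)

theorem isComputable_injuryData (hV : Computable V)
    (ha : Computable fun p : ℕ × ℕ => a p.1 p.2) : (injuryData V a c).IsComputable where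
  adj := ha
  seen := computable_injuryData_seen hV ha .fst .snd
  early := computable_injuryData_early hV ha (Computable.fst.comp .fst)
    (Computable.snd.comp .fst) (Computable.fst.comp .snd) (Computable.snd.comp .snd)

theorem isLawful_injuryData
    (hc : ∀ {w}, (c.eval w).Dom → {v | a w v = true}.Finite) :
    (injuryData V a c).IsLawful where
  seen_mono hst h := by
    rw [injuryData_seen] at *
    exact fun hV => (h hV).imp fun u hu => ⟨hu.1.trans_le hst, hu.2⟩
  early_mono hst h := by
    rw [injuryData_early] at *
    exact h.imp fun t ht => ⟨ht.1.trans hst, ht.2⟩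
  early_arg_lt h := by
    obtain ⟨t, hts, hw, -⟩ := injuryData_early.1 h
    exact (Code.evaln_bound hw).trans_le hts
  early_val_lt h := by
    obtain ⟨t, hts, -, ⟨k, hk⟩, -⟩ := injuryData_early.1 h
    exact (Code.evaln_bound hk).trans_le hts
  early_unique h h' := by
    obtain ⟨t, -, hw, -⟩ := injuryData_early.1 h
    obtain ⟨t', -, hw', -⟩ := injuryData_early.1 h'
    exact Part.mem_unique (Code.evaln_sound hw) (Code.evaln_sound hw')
  early_of_seen {e x w s t} hst hs h := by
    rw [injuryData_early] at *
    obtain ⟨r, -, hw, hk, hr⟩ := h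
    refine ⟨r, le_of_not_gt fun hlt => hr ?_, hw, hk, hr⟩
    rw [injuryData_seen] at *
    exact fun hV => (hs hV).imp fun u hu => ⟨hu.1.trans hlt, hu.2⟩
  finite_adj h := by
    obtain ⟨t, -, -, ⟨k, hk⟩, -⟩ := injuryData_early.1 h
    exact hc (Part.dom_iff_mem.2 ⟨k, Code.evaln_sound hk⟩)

end

/-! ### Partitions of graphs with isolated vertices. -/

theorem exists_adj_iff_of_iso {G : NatGraph} {X : Set ℕ} (φ : G.coe ≃g (G.induce X).coe)
    (x : G.verts) : (∃ u, G.Adj x u) ↔ ∃ u ∈ X, G.Adj (φ x) u := by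
  constructor
  · rintro ⟨u, hu⟩
    have h : (G.induce X).coe.Adj (φ x) (φ ⟨u, hu.snd_mem⟩) := φ.map_adj_iff.2 hu
    have h' : (G.induce X).Adj (φ x) (φ ⟨u, hu.snd_mem⟩) := h
    exact ⟨_, h'.2.1, h'.2.2⟩
  · rintro ⟨u, huX, hu⟩
    obtain ⟨y, hy⟩ := φ.surjective ⟨u, huX⟩
    have h : (G.induce X).coe.Adj (φ x) (φ y) := by
      rw [hy]
      exact ⟨(φ x).2, huX, hu⟩
    exact ⟨y, φ.map_adj_iff.1 h⟩

/-- The case where the isolated vertices cannot be enumerated. -/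
theorem exists_partition_of_not_rePred {G : NatGraph} (hG : G.IsComputable)
    (hF : REPred fun x => G.HasFiniteDegree x) (hI : ¬ REPred fun x => G.IsIsolatedVertex x) :
    ∃ X₀ X₁ : Set ℕ, G.IsComputablePartition X₀ X₁ ∧
      ¬ ComputablyIsomorphic G (G.induce X₀) ∧ ¬ ComputablyIsomorphic G (G.induce X₁) := by
  obtain ⟨V, hVc, hV⟩ := hG.1.exists_bool
  obtain ⟨a', hac, ha'⟩ := hG.2.exists_bool
  obtain ⟨c, hc⟩ := exists_code_of_rePred hF
  set a : ℕ → ℕ → Bool := fun u v => a' (u, v)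
  have ha : ∀ u v, a u v = true ↔ G.Adj u v := fun u v => ha' (u, v)
  have hnbr : ∀ w, {v | a w v = true} = {y | y ∈ G.verts ∧ G.Adj w y} := fun w => by
    ext v
    simp only [Set.mem_ofPred_eq, ha]
    exact ⟨fun h => ⟨h.snd_mem, h⟩, And.right⟩
  have hC : (injuryData V a c).IsComputable := isComputable_injuryData hVc hac
  have hL : (injuryData V a c).IsLawful :=
    isLawful_injuryData
      fun {w} h => hnbr w ▸ ((hc w).1 h).2
  have hseen : ∀ x, (∀ s, ¬ (injuryData V a c).seen x s = true) ↔ G.IsIsolatedVertex x := by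
    intro x
    simp only [injuryData_seen, ha, hV]
    constructor
    · intro h
      push Not at h
      exact ⟨(h 0).1, fun y _ hy => (h (y + 1)).2 y y.lt_succ_self hy⟩
    · rintro ⟨hx, h⟩ s hs
      obtain ⟨u, -, hu⟩ := hs hx
      exact h u hu.snd_mem hu
  have hI' : ¬ REPred fun x => ∀ s, ¬ (injuryData V a c).seen x s = true :=
    fun h => hI (h.of_eq hseen)
  set b := (injuryData V a c).bits
  have hb : Computable b := InjuryData.computable_bits hC
  have hX : ∀ i : Bool, ComputablePred fun x => x ∈ {v | v ∈ G.verts ∧ b v = i} := fun i =>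
    hG.1.and_pred ((Computable.bool_beq hb (.const i)).computablePred_of_iff fun x => beq_iff_eq)
  have hmain : ∀ i : Bool, ¬ ComputablyIsomorphic G (G.induce {v | v ∈ G.verts ∧ b v = i}) := by
    rintro i ⟨φ, f, hf, hφ⟩
    obtain ⟨d, rfl⟩ := Code.exists_code.1 hf
    have hiso := exists_adj_iff_of_iso φ
    obtain ⟨x, ⟨⟨s, hs⟩, w, t, he, -, hw⟩ | ⟨hx, hno⟩⟩ :=
      hL.exists_failure hC hI' (Encodable.encode d) i
    · obtain ⟨r, -, hwr, -, hr⟩ := injuryData_early.1 he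
      rw [injuryData_seen] at hr hs
      push Not at hr
      have hxV : x ∈ G.verts := (hV x).1 hr.1
      obtain ⟨u, -, hu⟩ := hs hr.1
      rw [Denumerable.ofNat_encode] at hwr
      have hev := Code.evaln_sound hwr
      rw [hφ ⟨x, hxV⟩, Part.mem_some_iff] at hev
      obtain ⟨v, hvX, hv⟩ := (hiso ⟨x, hxV⟩).1 ⟨u, (ha _ _).1 hu⟩
      exact hw v ((ha _ _).2 (hev ▸ hv)) hvX.2
    · have hxI := (hseen x).1 hx
      set y := φ ⟨x, hxI.1⟩ with hy
      have hyX : (y : ℕ) ∈ G.verts ∧ b y = i := y.2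
      have hyiso : ∀ u, G.Adj y u → b u ≠ i := fun u hu hbu => by
        obtain ⟨v, hv⟩ := (hiso ⟨x, hxI.1⟩).2 ⟨u, ⟨hu.snd_mem, hbu⟩, hu⟩
        exact hxI.2 v hv.snd_mem hv
      -- The image `y` is isolated on side `i`. If its degree is finite, it becomes an early value,
      -- which `hno` forbids; if infinite, attraction gave it a neighbor on that side.
      by_cases hfin : G.HasFiniteDegree y
      · obtain ⟨k, hk⟩ := Part.dom_iff_mem.1 ((hc y).2 hfin)
        obtain ⟨t₁, h₁⟩ := Code.evaln_complete.1 hk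
        have hyv : (y : ℕ) ∈ d.eval x := by
          rw [hφ ⟨x, hxI.1⟩]
          exact Part.mem_some _
        obtain ⟨t₂, h₂⟩ := Code.evaln_complete.1 hyv
        refine hno ⟨y, max t₁ t₂, injuryData_early.2 ⟨_, le_rfl, ?_, ⟨k, ?_⟩, hx _⟩, hyX.2,
          fun u hu => hyiso u ((ha _ _).1 hu)⟩
        · rw [Denumerable.ofNat_encode]
          exact Code.evaln_mono (le_max_right _ _) h₂
        · exact Code.evaln_mono (le_max_left _ _) h₁
      · obtain ⟨u, hu, hbu⟩ := hL.exists_adj_bits_eq hC hI' (w := y)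
          (fun h => hfin ⟨hyX.1, hnbr y ▸ h⟩) i
        exact hyiso u ((ha _ _).1 hu) hbu
  refine ⟨_, _, ⟨hX false, hX true, ?_, ?_⟩, hmain false, hmain true⟩
  · ext v
    cases h : b v <;> simp [h]
  · rw [Set.disjoint_left]
    rintro v ⟨-, h⟩ ⟨-, h'⟩
    rw [h] at h'
    cases h'

/-- The case where the isolated vertices are computably enumerable. -/
theorem exists_partition_of_rePred {G : NatGraph} (hG : G.IsComputable)
    (hV : G.verts.Nontrivial) (hz : ∃ x, G.IsIsolatedVertex x)
    (hne : IsEmpty (G.coe ≃g (⊥ : SimpleGraph ℕ))) (hI : REPred fun x => G.IsIsolatedVertex x) :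
    ∃ X₀ X₁ : Set ℕ, G.IsComputablePartition X₀ X₁ ∧
      ¬ ComputablyIsomorphic G (G.induce X₀) ∧ ¬ ComputablyIsomorphic G (G.induce X₁) := by
  by_cases hedge : ∃ u v, G.Adj u v
  · have hcomp : ComputablePred fun x => G.IsIsolatedVertex x := by
      refine ComputablePred.computable_iff_re_compl_re'.2 ⟨hI, ?_⟩
      obtain ⟨V, hVc, hV⟩ := hG.1.exists_bool
      obtain ⟨a, hac, ha⟩ := hG.2.exists_bool
      refine (Computable.rePred_exists
        (Computable.bool_or (Computable.bool_not (hVc.comp .fst)) hac)).of_eq fun x => ?_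
      simp only [IsIsolatedVertex, Bool.or_eq_true, Bool.not_eq_true', ha, ← Bool.not_eq_true, hV]
      constructor
      · rintro ⟨s, h | h⟩ ⟨h1, h2⟩
        · exact h h1
        · exact h2 s h.snd_mem h
      · intro h
        by_cases hx : x ∈ G.verts
        · by_contra hc
          push Not at hc
          exact h ⟨hx, fun y _ => (hc y).2⟩
        · exact ⟨0, Or.inl hx⟩
    -- A neighbor of a non-isolated vertex is itself non-isolated, so the second side keeps all
    -- edges.
    refine ⟨{x | G.IsIsolatedVertex x}, {x | x ∈ G.verts ∧ ¬ G.IsIsolatedVertex x},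
      ⟨hcomp, hG.1.and_pred hcomp.not, ?_, ?_⟩, ?_, ?_⟩
    · ext x
      simp only [Set.mem_union, Set.mem_ofPred_eq]
      exact ⟨fun h => h.elim And.left And.left,
        fun h => (em _).imp id fun h' => ⟨h, h'⟩⟩
    · exact Set.disjoint_left.2 fun x h h' => h'.2 h
    · rintro ⟨φ, -⟩
      obtain ⟨u, v, huv⟩ := hedge
      obtain ⟨w, hw, hadj⟩ := (exists_adj_iff_of_iso φ ⟨u, huv.fst_mem⟩).1 ⟨v, huv⟩
      exact hw.2 _ hadj.fst_mem hadj.symm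
    · rintro ⟨φ, -⟩
      obtain ⟨z, hz⟩ := hz
      have hmem : (φ ⟨z, hz.1⟩ : ℕ) ∈ G.verts ∧ ¬ G.IsIsolatedVertex (φ ⟨z, hz.1⟩) := (φ ⟨z, hz.1⟩).2
      have hex : ∃ u, G.Adj (φ ⟨z, hz.1⟩) u := by
        by_contra hc
        push Not at hc
        exact hmem.2 ⟨hmem.1, fun y _ => hc y⟩
      obtain ⟨u, hu⟩ := hex
      obtain ⟨v, hv⟩ := (exists_adj_iff_of_iso φ ⟨z, hz.1⟩).2
        ⟨u, ⟨hu.snd_mem, fun h => h.2 _ hu.fst_mem hu.symm⟩, hu⟩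
      exact hz.2 v hv.snd_mem hv
  · have hfin : G.verts.Finite := by
      -- An infinite edgeless graph is excluded by `hne`: any bijection with `ℕ` is an isomorphism
      -- onto `⊥`.
      by_contra hinf
      have : Infinite G.verts := Set.infinite_coe_iff.2 hinf
      obtain ⟨f⟩ := nonempty_equiv_of_countable (α := G.verts) (β := ℕ)
      exact hne.false ⟨f, fun {u v} => ⟨fun h => h.elim, fun h => hedge ⟨u, v, h⟩⟩⟩
    have hproper : ∀ X ⊂ G.verts, ¬ ComputablyIsomorphic G (G.induce X) := by
      rintro X hX ⟨φ, -⟩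
      exact (Set.ncard_lt_ncard hX hfin).ne (Nat.card_congr φ.toEquiv).symm
    obtain ⟨x, hx, y, hy, hxy⟩ := hV
    have hc : ComputablePred fun v => v = x :=
      (Computable.bool_beq Computable.id (.const x)).computablePred_of_iff fun v => beq_iff_eq
    refine ⟨{x}, {v | v ∈ G.verts ∧ ¬ v = x}, ⟨hc, hG.1.and_pred hc.not, ?_, ?_⟩,
      hproper _ ?_, hproper _ ?_⟩
    · ext v
      by_cases h : v = x <;> simp [h, hx]
    · simp
    · exact ⟨by simpa using hx, fun h => hxy (h hy).symm⟩
    · exact ⟨fun v => And.left, fun h => (h hx).2 rfl⟩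

theorem exists_partition_of_isolated {G : NatGraph} (hG : G.IsComputable)
    (hV : G.verts.Nontrivial) (hz : ∃ x, G.IsIsolatedVertex x)
    (hne : IsEmpty (G.coe ≃g (⊥ : SimpleGraph ℕ))) (hF : REPred fun x => G.HasFiniteDegree x) :
    ∃ X₀ X₁ : Set ℕ, G.IsComputablePartition X₀ X₁ ∧
      ¬ ComputablyIsomorphic G (G.induce X₀) ∧ ¬ ComputablyIsomorphic G (G.induce X₁) := by
  by_cases hI : REPred fun x => G.IsIsolatedVertex x
  · exact exists_partition_of_rePred hG hV hz hne hI
  · exact exists_partition_of_not_rePred hG hF hI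

/-! ### Complements -/

/-- The complement of `G` on the same vertex set. -/
def complement (G : NatGraph) : NatGraph where
  verts := G.verts
  Adj x y := (x ∈ G.verts ∧ y ∈ G.verts) ∧ x ≠ y ∧ ¬ G.Adj x y
  adj_sub h := h.2.1
  edge_vert h := h.1.1
  symm := ⟨fun _ _ h => ⟨h.1.symm, h.2.1.symm, fun h' => h.2.2 h'.symm⟩⟩

theorem IsComputable.complement {G : NatGraph} (hG : G.IsComputable) :
    G.complement.IsComputable := by
  refine ⟨hG.1, ?_⟩
  obtain ⟨V, hVc, hV⟩ := hG.1.exists_bool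
  have hmem : ComputablePred fun p : ℕ × ℕ => p.1 ∈ G.verts ∧ p.2 ∈ G.verts :=
    ((hVc.comp .fst).computablePred_of_iff fun p => hV _).and_pred
      ((hVc.comp .snd).computablePred_of_iff fun p => hV _)
  have hne : ComputablePred fun p : ℕ × ℕ => ¬ p.1 = p.2 :=
    ((Computable.bool_beq .fst .snd).computablePred_of_iff fun p => beq_iff_eq).not
  exact hmem.and_pred (hne.and_pred hG.2.not)

theorem complement_adj_iff_of_iso {G : NatGraph} {X : Set ℕ} (hX : X ⊆ G.verts)
    (φ : G.coe ≃g (G.induce X).coe) (u v : G.verts) :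
    (G.complement.induce X).Adj (φ u) (φ v) ↔ G.complement.Adj u v := by
  have h : (G.induce X).Adj (φ u) (φ v) ↔ G.Adj u v := φ.map_adj_iff
  have hu : (φ u : ℕ) ∈ X := (φ u).2
  have hv : (φ v : ℕ) ∈ X := (φ v).2
  have hne : (φ u : ℕ) = φ v ↔ (u : ℕ) = v := by
    rw [Subtype.coe_inj, φ.injective.eq_iff, Subtype.coe_inj]
  have h' : G.Adj (φ u) (φ v) ↔ G.Adj u v := by
    rw [← h]
    exact ⟨fun h => ⟨hu, hv, h⟩, fun h => h.2.2⟩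
  simp only [SimpleGraph.Subgraph.induce_adj, complement, hu, hv, hX hu, hX hv, u.2, v.2, h', hne,
    ne_eq, true_and]

theorem ComputablyIsomorphic.complement {G : NatGraph} {X : Set ℕ} (hX : X ⊆ G.verts)
    (h : ComputablyIsomorphic G (G.induce X)) :
    ComputablyIsomorphic G.complement (G.complement.induce X) := by
  obtain ⟨φ, f, hf, hφ⟩ := h
  exact ⟨⟨φ.toEquiv, fun {u v} => complement_adj_iff_of_iso hX φ u v⟩, f, hf, hφ⟩

theorem exists_partition_of_universal {G : NatGraph} (hG : G.IsComputable)
    (hV : G.verts.Nontrivial) (hz : ∃ x, G.IsUniversalVertex x)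
    (hne : IsEmpty (G.coe ≃g (⊤ : SimpleGraph ℕ))) (hF : REPred fun x => G.HasCofiniteDegree x) :
    ∃ X₀ X₁ : Set ℕ, G.IsComputablePartition X₀ X₁ ∧
      ¬ ComputablyIsomorphic G (G.induce X₀) ∧ ¬ ComputablyIsomorphic G (G.induce X₁) := by
  have hz' : ∃ x, G.complement.IsIsolatedVertex x :=
    hz.imp fun x hx => ⟨hx.1, fun y hy h => h.2.2 (hx.2 y hy h.2.1.symm)⟩
  have hne' : IsEmpty (G.complement.coe ≃g (⊥ : SimpleGraph ℕ)) := by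
    refine ⟨fun φ => hne.false ⟨φ.toEquiv, fun {u v} => ?_⟩⟩
    have h : ¬ G.complement.Adj u v := fun h => (φ.map_adj_iff.2 h : (⊥ : SimpleGraph ℕ).Adj _ _)
    have hinj : φ u ≠ φ v ↔ u ≠ v := φ.injective.ne_iff
    refine hinj.trans ⟨fun huv => ?_, fun h huv => ?_⟩
    · by_contra hc
      exact h ⟨⟨u.2, v.2⟩, fun h => huv (Subtype.ext h), hc⟩
    · subst huv
      exact (G.adj_sub h).ne rfl
  have hF' : REPred fun x => G.complement.HasFiniteDegree x := by
    refine hF.of_eq fun x => and_congr_right fun hx => ?_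
    constructor
    · exact fun h => h.subset fun y hy => ⟨hy.1, hy.2.2.2⟩
    -- The vertex `x` is a non-neighbor of itself in both graphs, hence the extra point.
    · refine fun h => (h.insert x).subset fun y hy => ?_
      by_cases hxy : y = x
      · exact Or.inl hxy
      · exact Or.inr ⟨hy.1, ⟨hx, hy.1⟩, fun h => hxy h.symm, hy.2⟩
  obtain ⟨X₀, X₁, hP, h₀, h₁⟩ := exists_partition_of_isolated hG.complement hV hz' hne' hF'
  have hU : X₀ ∪ X₁ = G.verts := hP.2.2.1
  exact ⟨X₀, X₁, hP, fun h => h₀ (h.complement (hU ▸ Set.subset_union_left)),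
    fun h => h₁ (h.complement (hU ▸ Set.subset_union_right))⟩

end NatGraph

theorem theorem4p1 (G : NatGraph) (hG : G.IsComputable) (hV : G.verts.Nontrivial) :
    ((∃ x, G.IsIsolatedVertex x) → IsEmpty (G.coe ≃g (⊥ : SimpleGraph ℕ)) →
      REPred (fun x : ℕ => G.HasFiniteDegree x) →
      ∃ X₀ X₁ : Set ℕ, G.IsComputablePartition X₀ X₁ ∧
        ¬ NatGraph.ComputablyIsomorphic G (G.induce X₀) ∧
        ¬ NatGraph.ComputablyIsomorphic G (G.induce X₁)) ∧
    ((∃ x, G.IsUniversalVertex x) → IsEmpty (G.coe ≃g (⊤ : SimpleGraph ℕ)) →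
      REPred (fun x : ℕ => G.HasCofiniteDegree x) →
      ∃ X₀ X₁ : Set ℕ, G.IsComputablePartition X₀ X₁ ∧
        ¬ NatGraph.ComputablyIsomorphic G (G.induce X₀) ∧
        ¬ NatGraph.ComputablyIsomorphic G (G.induce X₁)) :=
  ⟨NatGraph.exists_partition_of_isolated hG hV, NatGraph.exists_partition_of_universal hG hV⟩
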